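/- Let $R=\bigoplus_{n\ge 0}R^n$ be a graded-commutative unital differential graded algebra over $\mathbb{Q}$ with differential $d$ of degree $+1$. For $X\in \mathrm{GL}_k(R^0)$ and $m\ge 0$ put $\beta^m_X=\mathrm{tr}\big((X^{-1}dX)^m\big)\in R^m$; for $u\in (R^0)^\times$ put $d\log u=u^{-1}du$. Let $\mathbb{Q}[a_{i,j}]$ (respectively $\mathbb{Q}[a_{\{i,j\}}]$) be the polynomial ring in the entries of the generic $k\times k$ matrix $(a_{i,j})$ (respectively the generic symmetric $k\times k$ matrix $(a_{\{i,j\}})$, whose variables are indexed by unordered pairs, $i=j$ allowed), with Kähler differential forms $\Omega^\bullet_{\mathbb{Q}[a_{i,j}]/\mathbb{Q}}$ (respectively $\Omega^\bullet_{\mathbb{Q}[a_{\{i,j\}}]/\mathbb{Q}}$). Theorem. Let $k\ge 0$. (i) For every invertible $k\times k$ matrix $X$ over $R^0$, $\beta^1_X=d\log(\det X)$. The same holds for the generic matrix and for the generic symmetric matrix, with forms taken in $\Omega^\bullet_{K/\mathbb{Q}}$, $K=\mathbb{Q}(a_{i,j})$ respectively $K=\mathbb{Q}(a_{\{i,j\}})$.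 (ii) For every $n\ge 0$, $$\beta^{2n+1}_X\in \frac{1}{\det(X)^{n+1}}\,\Omega^{2n+1}_{\mathbb{Q}[a_{i,j}]/\mathbb{Q}} .$$ That is, there is a polynomial form $\eta\in\Omega^{2n+1}_{\mathbb{Q}[a_{i,j}]/\mathbb{Q}}$, depending only on $k$ and $n$, such that $\beta^{2n+1}_X=\det(X)^{-(n+1)}\,\eta$ in $\Omega^\bullet_{\mathbb{Q}(a_{i,j})/\mathbb{Q}}$ for the generic matrix $X=(a_{i,j})$, and such that, for every $R$ and every $X\in\mathrm{GL}_k(R^0)$, $\beta^{2n+1}_X=\det(X)^{-(n+1)}\,\eta(X)$, where $\eta(X)\in R$ is obtained from $\eta$ by substituting $a_{i,j}\mapsto X_{ij}$, $da_{i,j}\mapsto dX_{ij}$. (iii) For every $n\ge 0$ and symmetric $X$, $$\beta^{4n+1}_X\in \frac{1}{\det(X)^{n+1}}\,\Omega^{4n+1}_{\mathbb{Q}[a_{\{i,j\}}]/\mathbb{Q}} .$$ That is, there is a polynomial form $\eta\in\Omega^{4n+1}_{\mathbb{Q}[a_{\{i,j\}}]/\mathbb{Q}}$, depending only on $k$ and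 $n$, such that $\beta^{4n+1}_X=\det(X)^{-(n+1)}\,\eta$ in $\Omega^\bullet_{\mathbb{Q}(a_{\{i,j\}})/\mathbb{Q}}$ for the generic symmetric matrix $X=(a_{\{i,j\}})$, and such that, for every $R$ and every symmetric $X\in\mathrm{GL}_k(R^0)$, $\beta^{4n+1}_X=\det(X)^{-(n+1)}\,\eta(X)$, where $\eta(X)\in R$ is obtained from $\eta$ by substituting $a_{\{i,j\}}\mapsto X_{ij}$, $da_{\{i,j\}}\mapsto dX_{ij}$. -/

import Mathlib

open Matrix MvPolynomial

universe u

/-- A graded-commutative unital differential graded algebra `R = ⨁ Rⁿ` over `ℚ`, with homogeneous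
pieces `𝒜 n = Rⁿ` and differential of degree `+1`. -/
class CommDGAlgebra {R : Type u} [Ring R] [Algebra ℚ R] (𝒜 : ℕ → Submodule ℚ R)
    [GradedAlgebra 𝒜] where
  /-- the differential -/
  d : R →ₗ[ℚ] R
  d_mem : ∀ (n : ℕ) (a : R), a ∈ 𝒜 n → d a ∈ 𝒜 (n + 1)
  d_d : ∀ a : R, d (d a) = 0
  leibniz : ∀ (n : ℕ) (a b : R), a ∈ 𝒜 n → d (a * b) = d a * b + (-1) ^ n * (a * d b)
  graded_comm : ∀ (m n : ℕ) (a b : R), a ∈ 𝒜 m → b ∈ 𝒜 n → a * b = (-1) ^ (m * n) * (b * a)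

section General

variable {A : Type*} [CommRing A] [Algebra ℚ A] {R : Type*} [Ring R] [Algebra ℚ R] [Algebra A R]

/-- The invariant trace `β^m_X = tr ((X⁻¹ dX)^m)` of an invertible matrix `X` over `A`, computed in
an `A`-algebra `R` containing the differentials `da` of the elements of `A`. -/
def invariantTrace (d : Derivation ℚ A R) {k : ℕ} (X : GL (Fin k) A) (m : ℕ) : R :=
  (((X⁻¹).val.map (algebraMap A R) * X.val.map d) ^ m).trace

/-- The logarithmic differential `d log u = u⁻¹ du` of an invertible element `u`. -/
def dlog (d : Derivation ℚ A R) (u : Aˣ) : R :=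
  (u⁻¹).val • d u.val

/-- The algebra `Ω^•_{B/ℚ}` of Kähler differential forms; its part of degree `m` is
`⋀[B]^m Ω[B⁄ℚ]`. -/
abbrev KahlerForms (B : Type*) [CommRing B] [Algebra ℚ B] : Type _ :=
  ExteriorAlgebra B Ω[B⁄ℚ]

/-- The differential `Ω⁰ → Ω¹` of the algebra of Kähler forms. -/
noncomputable def kahlerD (B : Type*) [CommRing B] [Algebra ℚ B] :
    Derivation ℚ B (KahlerForms B) :=
  (ExteriorAlgebra.ι B).compDer (KaehlerDifferential.D ℚ B)

theorem kahlerD_anticomm (B : Type*) [CommRing B] [Algebra ℚ B] (a b : B) :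
    kahlerD B a * kahlerD B b = -(kahlerD B b * kahlerD B a) :=
  eq_neg_of_add_eq_zero_left (ExteriorAlgebra.ι_add_mul_swap _ _)

theorem sq_zero_of_anticomm (d : Derivation ℚ A R) (hd : ∀ a b, d a * d b = -(d b * d a))
    {v : R} (hv : v ∈ Submodule.span A (Set.range d)) : v * v = 0 := by
  have key : ∀ w ∈ Submodule.span A (Set.range d), ∀ a, w * d a = -(d a * w) := by
    intro w hw a
    induction hw using Submodule.span_induction with
    | mem x hx => obtain ⟨b, rfl⟩ := hx; exact hd b a
    | zero => simp
    | add x y _ _ hx hy => rw [add_mul, mul_add, hx, hy, neg_add]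
    | smul c x _ hx => rw [smul_mul_assoc, mul_smul_comm, hx, smul_neg]
  have key2 : ∀ w ∈ Submodule.span A (Set.range d), v * w = -(w * v) := by
    intro w hw
    induction hw using Submodule.span_induction with
    | mem x hx => obtain ⟨b, rfl⟩ := hx; exact key v hv b
    | zero => simp
    | add x y _ _ hx hy => rw [add_mul, mul_add, hx, hy, neg_add]
    | smul c x _ hx => rw [smul_mul_assoc, mul_smul_comm, hx, smul_neg]
  have h := key2 v hv
  have h2 : (2 : ℚ) • (v * v) = 0 := by
    rw [two_smul]; nth_rewrite 1 [h]; exact neg_add_cancel _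
  have h3 := congrArg (fun w => (2⁻¹ : ℚ) • w) h2
  simpa [smul_smul] using h3

/-- The specialization of differential forms along a homomorphism `f : B → A`: the unique ring
homomorphism `Ω^•_{B/ℚ} → R` with `b ↦ f b` and `db ↦ d (f b)` for `b ∈ B`. -/
noncomputable def specialize {B : Type*} [CommRing B] [Algebra ℚ B] (d : Derivation ℚ A R)
    (hd : ∀ a b, d a * d b = -(d b * d a)) (f : B →ₐ[ℚ] A) : KahlerForms B →+* R :=
  letI : Algebra B R := ((algebraMap A R).comp f.toRingHom).toAlgebra' fun c x => by
    simpa using Algebra.commutes (f c) x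
  letI D : Derivation ℚ B R := Derivation.mk' (d.toLinearMap.comp f.toLinearMap) fun a b => by
    simp only [LinearMap.comp_apply, AlgHom.toLinearMap_apply, map_mul, Derivation.coeFn_coe,
      Derivation.leibniz, Algebra.smul_def]
    rfl
  (ExteriorAlgebra.lift B ⟨D.liftKaehlerDifferential, fun m => by
    refine sq_zero_of_anticomm d hd ?_
    have hm : m ∈ Submodule.span B (Set.range (KaehlerDifferential.D ℚ B)) := by
      rw [KaehlerDifferential.span_range_derivation]; trivial
    induction hm using Submodule.span_induction with
    | mem x hx =>
      obtain ⟨b, rfl⟩ := hx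
      rw [Derivation.liftKaehlerDifferential_comp_D]
      exact Submodule.subset_span ⟨f b, rfl⟩
    | zero => rw [map_zero]; exact Submodule.zero_mem _
    | add x y _ _ hx hy => rw [map_add]; exact Submodule.add_mem _ hx hy
    | smul c x _ hx =>
      rw [map_smul, Algebra.smul_def]
      have := Submodule.smul_mem _ (f c) hx
      rw [Algebra.smul_def] at this
      exact this⟩).toRingHom

theorem specialize_algebraMap {B : Type*} [CommRing B] [Algebra ℚ B] (d : Derivation ℚ A R)
    (hd : ∀ a b, d a * d b = -(d b * d a)) (f : B →ₐ[ℚ] A) (b : B) :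
    specialize d hd f (algebraMap B (KahlerForms B) b) = algebraMap A R (f b) := by
  let : Algebra B R := ((algebraMap A R).comp f.toRingHom).toAlgebra' fun c x => by
    simpa using Algebra.commutes (f c) x
  exact AlgHom.commutes _ b

theorem specialize_kahlerD {B : Type*} [CommRing B] [Algebra ℚ B] (d : Derivation ℚ A R)
    (hd : ∀ a b, d a * d b = -(d b * d a)) (f : B →ₐ[ℚ] A) (b : B) :
    specialize d hd f (kahlerD B b) = d (f b) := by
  let : Algebra B R := ((algebraMap A R).comp f.toRingHom).toAlgebra' fun c x => by
    simpa using Algebra.commutes (f c) x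
  refine (ExteriorAlgebra.lift_ι_apply B _ _ _).trans ?_
  exact Derivation.liftKaehlerDifferential_comp_D _ b

/-- The entries of a symmetric matrix, as a function of the unordered pair of indices. -/
def symEntries {k : ℕ} (X : Matrix (Fin k) (Fin k) A) (hX : X.IsSymm) : Sym2 (Fin k) → A :=
  Sym2.lift ⟨fun i j => X i j, fun i j => hX.apply j i⟩

end General

namespace CommDGAlgebra

variable {R : Type u} [Ring R] [Algebra ℚ R] (𝒜 : ℕ → Submodule ℚ R) [GradedAlgebra 𝒜]
  [CommDGAlgebra 𝒜]

/-- The degree zero part `R⁰` is a commutative ring. -/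
instance degZeroCommRing : CommRing (𝒜 0) where
  __ := SetLike.GradeZero.instRing 𝒜
  mul_comm a b := Subtype.ext (by
    have h := graded_comm (𝒜 := 𝒜) 0 0 a.1 b.1 a.2 b.2
    simpa using h)

theorem degZero_commute (a : 𝒜 0) (x : R) : a.1 * x = x * a.1 := by
  induction x using DirectSum.Decomposition.inductionOn 𝒜 with
  | zero => simp
  | @homogeneous i m => simpa using graded_comm (𝒜 := 𝒜) 0 i a.1 m.1 a.2 m.2
  | add x y hx hy => rw [mul_add, add_mul, hx, hy]

/-- `R` is an algebra over its degree zero part, through the inclusion. -/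
instance degZeroAlgebra : Algebra (𝒜 0) R :=
  RingHom.toAlgebra'
    { toFun := fun a => a.1
      map_one' := rfl
      map_mul' := fun _ _ => rfl
      map_zero' := rfl
      map_add' := fun _ _ => rfl }
    (degZero_commute 𝒜)

/-- The differential restricted to degree zero, `R⁰ → R¹ ⊆ R`. -/
def dZero : Derivation ℚ (𝒜 0) R :=
  Derivation.mk' ((d 𝒜).comp (𝒜 0).subtype) fun a b => by
    have h := leibniz (𝒜 := 𝒜) 0 a.1 b.1 a.2
    have h2 := degZero_commute 𝒜 b (d 𝒜 a.1)
    rw [pow_zero, one_mul, ← h2, add_comm] at h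
    exact h

theorem dZero_apply (a : 𝒜 0) : dZero 𝒜 a = d 𝒜 a.1 := rfl

theorem dZero_anticomm (a b : 𝒜 0) : dZero 𝒜 a * dZero 𝒜 b = -(dZero 𝒜 b * dZero 𝒜 a) := by
  have h := graded_comm (𝒜 := 𝒜) 1 1 (d 𝒜 a.1) (d 𝒜 b.1)
    (d_mem 0 a.1 a.2) (d_mem 0 b.1 b.2)
  simpa [dZero_apply] using h

end CommDGAlgebra

section Generic

variable (k : ℕ)

/-- The polynomial ring `ℚ[a_{i,j}]`. -/
abbrev GenRing : Type := MvPolynomial (Fin k × Fin k) ℚ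

/-- The polynomial ring `ℚ[a_{\{i,j\}}]`, with variables indexed by unordered pairs (`i = j`
allowed). -/
abbrev SymRing : Type := MvPolynomial (Sym2 (Fin k)) ℚ

/-- The generic `k × k` matrix `(a_{i,j})`. -/
noncomputable def genMatrix : Matrix (Fin k) (Fin k) (GenRing k) :=
  Matrix.of fun i j => X (i, j)

/-- The generic symmetric `k × k` matrix `(a_{\{i,j\}})`. -/
noncomputable def symMatrix : Matrix (Fin k) (Fin k) (SymRing k) :=
  Matrix.of fun i j => X s(i, j)

theorem det_genMatrix_ne_zero : (genMatrix k).det ≠ 0 :=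
  Matrix.det_mvPolynomialX_ne_zero (Fin k) ℚ

theorem det_symMatrix_ne_zero : (symMatrix k).det ≠ 0 := by
  intro h
  have h1 := congrArg (aeval (symEntries (1 : Matrix (Fin k) (Fin k) ℚ) Matrix.isSymm_one)) h
  rw [AlgHom.map_det, map_zero] at h1
  have h2 : (aeval (R := ℚ)
      (symEntries (1 : Matrix (Fin k) (Fin k) ℚ) Matrix.isSymm_one)).mapMatrix (symMatrix k)
      = 1 := by
    ext i j
    simp [symMatrix, symEntries]
  rw [h2, Matrix.det_one] at h1
  exact one_ne_zero h1

/-- The generic matrix as an element of `GL_k(ℚ(a_{i,j}))`. -/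
noncomputable def genGL : GL (Fin k) (FractionRing (GenRing k)) :=
  Matrix.GeneralLinearGroup.mkOfDetNeZero
    ((genMatrix k).map (algebraMap (GenRing k) (FractionRing (GenRing k)))) (by
      have h := RingHom.map_det (algebraMap (GenRing k) (FractionRing (GenRing k))) (genMatrix k)
      rw [RingHom.mapMatrix_apply] at h
      rw [← h]
      exact fun h0 => det_genMatrix_ne_zero k
        (IsFractionRing.injective (GenRing k) (FractionRing (GenRing k)) (h0.trans (map_zero _).symm)))

/-- The generic symmetric matrix as an element of `GL_k(ℚ(a_{\{i,j\}}))`. -/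
noncomputable def symGL : GL (Fin k) (FractionRing (SymRing k)) :=
  Matrix.GeneralLinearGroup.mkOfDetNeZero
    ((symMatrix k).map (algebraMap (SymRing k) (FractionRing (SymRing k)))) (by
      have h := RingHom.map_det (algebraMap (SymRing k) (FractionRing (SymRing k))) (symMatrix k)
      rw [RingHom.mapMatrix_apply] at h
      rw [← h]
      exact fun h0 => det_symMatrix_ne_zero k
        (IsFractionRing.injective (SymRing k) (FractionRing (SymRing k)) (h0.trans (map_zero _).symm)))

/-- The natural map `Ω^•_{ℚ[σ]/ℚ} → Ω^•_{ℚ(σ)/ℚ}` from polynomial forms to forms over the field of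
rational functions. -/
noncomputable def toFractionForms (σ : Type) :
    KahlerForms (MvPolynomial σ ℚ) →+* KahlerForms (FractionRing (MvPolynomial σ ℚ)) :=
  specialize (kahlerD (FractionRing (MvPolynomial σ ℚ))) (kahlerD_anticomm _)
    (algebraMap (MvPolynomial σ ℚ) (FractionRing (MvPolynomial σ ℚ))).toRatAlgHom

end Generic

/-!
Write `Y = X⁻¹`, `ω = Y dX` and `A = dX Y dX`. The entries of `A` are two-forms, so they commute, and
`ω² = Y A`. The traces of the even powers of `ω` vanish because its entries anticommute; hence all
elementary symmetric functions of `S = Y A` vanish, and the recursion expressing sums of bordered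
minors of `S` through its powers keeps only one term (`sum_det_borderedColumns`). Expanding `S = Y A`
by multilinearity gives

`(Sᴺ Y)(l, q) = (-1)ᴺ / N! · ∑ det Y[(l, i), (q, j)] · ∏ A(j_b, i_b)`,

the sum being over `i, j : Fin N → Fin k` (`sum_minor_mul_prod`). Every minor of `Y`, of whatever
size, has only a simple pole along `det X`: times `det X` it is a bordered determinant
(`det_inv_submatrix`).

For the general matrix, `β^{2n+1} = tr (Sⁿ Y dX)` is thus a contraction of minors of `Y` of size
`n + 1` with `n` entries of `A`, each having a simple pole. This gives the pole order `n + 1`.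

For symmetric `X` the matrix `A` is skew-symmetric, and `β^{4n+1} = tr (S²ⁿ Y dX)` is a contraction of
minors of `Y` of size `2n + 1` with `2n` entries of `A`. The minors of a symmetric matrix satisfy an
exchange relation between row and column indices (`minorAt_eq_sum_swap`), an infinitesimal
`SL₂`-invariance. It shows that, up to positive factors, `A(j, i) A(j', i')` may be replaced by
`A(j, j') A(i, i')`, and hence by the sum of the two (`minorPairing_prod_add`). As one-forms
anticommute, that sum is linear in the minors `Y_ab Y_ce - Y_ac Y_be` of size two, so it has only a
simple pole. There are `n` such factors, and the pole order is `n + 1`.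

The resulting numerators `traceNumerator` and `symTraceNumerator` are explicit polynomials in the
entries of `X` and `dX`, so they are compatible with specialization. The case of `β¹` is Jacobi's
formula (`Derivation.map_det`).
-/

/-! ### Minors of the inverse matrix -/

section Minors

variable {ι σ : Type*} [Fintype ι] [DecidableEq ι] [Fintype σ] [DecidableEq σ]
  {C : Type*} [CommRing C]

theorem val_inv_eq_smul_adjugate (X : GL ι C) :
    (X⁻¹).val = (GeneralLinearGroup.det X)⁻¹.val • adjugate X.val := by
  rw [Matrix.coe_units_inv, Matrix.inv_def, ← GeneralLinearGroup.val_det_apply, Ring.inverse_unit]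

/-- The bordered determinant attached to rows `p` and columns `q`: a polynomial in the entries of
`X` which, for `X` invertible, equals `det X` times the minor `X⁻¹[p, q]`. -/
def borderedMinor (X : Matrix ι ι C) (p q : σ → ι) : C :=
  (fromBlocks X ((1 : Matrix ι ι C).submatrix id q)
    (-(1 : Matrix ι ι C).submatrix p id) 0).det

theorem det_inv_submatrix (X : GL ι C) (p q : σ → ι) :
    ((X⁻¹).val.submatrix p q).det =
      (GeneralLinearGroup.det X)⁻¹.val * borderedMinor X.val p q := by
  have : Invertible X.val := X.invertible
  have h2 : ⅟X.val = (X⁻¹).val := by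
    rw [Matrix.invOf_eq_nonsing_inv, Matrix.coe_units_inv]
  have h : borderedMinor X.val p q = X.val.det * ((X⁻¹).val.submatrix p q).det := by
    rw [borderedMinor, det_fromBlocks₁₁, h2, zero_sub, Matrix.neg_mul, Matrix.neg_mul, neg_neg]
    congr 2
    ext i j
    simp [Matrix.mul_apply, Matrix.one_apply]
  rw [h, ← mul_assoc, ← GeneralLinearGroup.val_det_apply, Units.inv_mul, one_mul]

theorem det_map_inv_submatrix {C' : Type*} [CommRing C'] [Algebra C C'] (X : GL ι C)
    (p q : σ → ι) :
    (((X⁻¹).val.map (algebraMap C C')).submatrix p q).det =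
      algebraMap C C' ((GeneralLinearGroup.det X)⁻¹.val * borderedMinor X.val p q) := by
  rw [← det_inv_submatrix, RingHom.map_det, RingHom.mapMatrix_apply, submatrix_map]

theorem map_borderedMinor {C' : Type*} [CommRing C'] (φ : C →+* C') (X : Matrix ι ι C)
    (p q : σ → ι) : φ (borderedMinor X p q) = borderedMinor (X.map φ) p q := by
  rw [borderedMinor, RingHom.map_det, RingHom.mapMatrix_apply, borderedMinor, fromBlocks_map]
  congr 2
  · ext i j; simp [Matrix.one_apply, apply_ite φ]
  · ext i j; simp [Matrix.one_apply, apply_ite φ]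
  · ext i j; simp

end Minors

section Exchange

variable {ι σ : Type*} [Fintype σ] [DecidableEq σ] {C : Type*} [CommRing C]

/-- The minor of `Y` whose row indices are `f ∘ inl` and whose column indices are `f ∘ inr`. -/
def minorAt (Y : Matrix ι ι C) (f : σ ⊕ σ → ι) : C :=
  (Y.submatrix (f ∘ Sum.inl) (f ∘ Sum.inr)).det

theorem adjugate_congr_col {M N : Matrix σ σ C} {b : σ} (h : ∀ i j, j ≠ b → M i j = N i j)
    (a : σ) : adjugate M b a = adjugate N b a := by
  have key : ∀ M : Matrix σ σ C, adjugate M b a = (M.updateCol b (Pi.single a 1)).det := by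
    intro M
    rw [← transpose_apply (adjugate M), adjugate_transpose, adjugate_apply, ← det_transpose,
      updateRow_transpose, transpose_transpose]
  rw [key, key]
  congr 1
  ext i j
  by_cases hj : j = b
  · subst hj; simp
  · simp [updateCol_ne hj, h i j hj]

/-- The exchange relation for minors of a symmetric matrix: exchanging one fixed column index with
each of the row indices in turn, the minors add up to the original one. -/
theorem minorAt_eq_sum_swap {Y : Matrix ι ι C} (hY : Y.IsSymm) (f : σ ⊕ σ → ι) (b : σ) :
    minorAt Y f = ∑ a, minorAt Y (f ∘ Equiv.swap (Sum.inl a) (Sum.inr b)) := by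
  set M := Y.submatrix (f ∘ Sum.inl) (f ∘ Sum.inr) with hM
  set N : σ → Matrix σ σ C := fun a => M.updateRow a (fun c => Y (f (.inr b)) (f (.inr c))) with hN
  -- expansion of the exchanged minor along the column of `b`
  have h1 : ∀ a, minorAt Y (f ∘ Equiv.swap (Sum.inl a) (Sum.inr b)) =
      ∑ a', Y (f (.inl a')) (if a' = a then f (.inr b) else f (.inl a)) *
        adjugate (N a) b a' := by
    intro a
    rw [minorAt, det_eq_sum_mul_adjugate_col _ b]
    refine Finset.sum_congr rfl fun a' _ => ?_
    congr 1
    · by_cases h : a' = a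
      · subst h
        simp [hY.apply]
      · simp [h, Equiv.swap_apply_of_ne_of_ne]
    · refine adjugate_congr_col (fun i j hj => ?_) _
      by_cases h : i = a
      · subst h
        simp [hN, Equiv.swap_apply_of_ne_of_ne, hj]
      · simp [hN, h, hM, Equiv.swap_apply_of_ne_of_ne, hj]
  have hdiag : ∀ a, adjugate (N a) b a = adjugate M b a := by
    intro a
    simp [adjugate_apply, hN, updateRow_idem]
  have hanti : ∀ a a', a ≠ a' → adjugate (N a) b a' = -adjugate (N a') b a := by
    intro a a' h
    rw [adjugate_apply, adjugate_apply]
    have : (N a).updateRow a' (Pi.single b 1) =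
        ((N a').updateRow a (Pi.single b 1)).submatrix (Equiv.swap a a') id := by
      ext i j
      by_cases hi : i = a
      · subst hi; simp [hN, updateRow_ne h, updateRow_ne h.symm]
      · by_cases hi' : i = a'
        · subst hi'; simp
        · simp [hN, updateRow_ne hi, updateRow_ne hi', Equiv.swap_apply_of_ne_of_ne hi hi']
    rw [this, det_permute, Equiv.Perm.sign_swap h]
    simp
  have h0 : ∑ a, ∑ a' ∈ Finset.univ.erase a,
      Y (f (.inl a')) (f (.inl a)) * adjugate (N a) b a' = 0 := by
    rw [Finset.sum_sigma']
    refine Finset.sum_involution (fun x _ => ⟨x.2, x.1⟩) ?_ ?_ ?_ ?_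
    · rintro ⟨a, a'⟩ h
      have h' : a' ≠ a := by simpa using h
      simp only
      rw [hanti a a' h'.symm, hY.apply]
      ring
    · rintro ⟨a, a'⟩ h _ h3
      have h' : a' ≠ a := by simpa using h
      exact h' (by simpa using congrArg Sigma.fst h3)
    · rintro ⟨a, a'⟩ h
      simpa [eq_comm] using h
    · rintro ⟨a, a'⟩ h
      rfl
  calc minorAt Y f = ∑ a, Y (f (.inl a)) (f (.inr b)) * adjugate M b a :=
        det_eq_sum_mul_adjugate_col _ b
    _ = ∑ a, Y (f (.inl a)) (f (.inr b)) * adjugate M b a +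
        ∑ a, ∑ a' ∈ Finset.univ.erase a,
          Y (f (.inl a')) (f (.inl a)) * adjugate (N a) b a' := by rw [h0, add_zero]
    _ = _ := by
        rw [← Finset.sum_add_distrib]
        refine Finset.sum_congr rfl fun a _ => ?_
        rw [h1, ← Finset.add_sum_erase _ _ (Finset.mem_univ a)]
        congr 1
        · simp [hdiag]
        · refine Finset.sum_congr rfl fun a' h => ?_
          rw [if_neg (Finset.ne_of_mem_erase h)]

theorem minorAt_comp_inl (Y : Matrix ι ι C) (f : σ ⊕ σ → ι) (π : Equiv.Perm σ) :
    minorAt Y (f ∘ Equiv.sumCongr π (Equiv.refl σ)) = (Equiv.Perm.sign π : ℤ) * minorAt Y f := by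
  rw [minorAt, minorAt, ← det_permute]
  rfl

theorem minorAt_comp_inr (Y : Matrix ι ι C) (f : σ ⊕ σ → ι) (π : Equiv.Perm σ) :
    minorAt Y (f ∘ Equiv.sumCongr (Equiv.refl σ) π) = (Equiv.Perm.sign π : ℤ) * minorAt Y f := by
  rw [minorAt, minorAt, ← det_permute']
  rfl

end Exchange

/-! ### Powers of a matrix all of whose power traces vanish -/

section Powers

variable {ι : Type*} [Fintype ι] [DecidableEq ι] {C : Type*} [CommRing C]

/-- The matrix with rows indexed by `r` whose first column is the column `q` of `Z` and whose other
columns are the columns `i` of `S`. -/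
def borderedColumns (S Z : Matrix ι ι C) (q : ι) {N : ℕ} (r : Fin (N + 1) → ι) (i : Fin N → ι) :
    Matrix (Fin (N + 1)) (Fin (N + 1)) C :=
  Matrix.of fun a => Fin.cons (Z (r a) q) fun c => S (r a) (i c)

/-- If all the traces `tr S, tr S², …` vanish then the sums of bordered principal minors of `S` are,
up to a factor, powers of `S`: the other terms of the expansion along the bordering row are
multiples of the elementary symmetric functions of `S`, which vanish as well. -/
theorem sum_det_borderedColumns (S : Matrix ι ι C) (hS : ∀ j, 0 < j → (S ^ j).trace = 0) (N : ℕ) :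
    ∀ (Z : Matrix ι ι C) (l q : ι),
    ∑ i : Fin N → ι, (borderedColumns S Z q (Fin.cons l i) i).det =
      (-1) ^ N * N.factorial * (S ^ N * Z) l q := by
  induction N with
  | zero => intro Z l q; simp [borderedColumns]
  | succ N ih =>
    intro Z l q
    have hE : ∑ i : Fin (N + 1) → ι, (S.submatrix i i).det = 0 := by
      rw [← (Fin.consEquiv fun _ => ι).sum_comp, Fintype.sum_prod_type]
      have h : ∀ x : ι, ∑ i : Fin N → ι, (S.submatrix (Fin.cons x i) (Fin.cons x i)).det =
          (-1) ^ N * N.factorial * (S ^ (N + 1)) x x := by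
        intro x
        rw [pow_succ, ← ih S x x]
        refine Finset.sum_congr rfl fun i _ => ?_
        congr 1
        ext a b
        refine Fin.cases ?_ (fun c => ?_) b <;> simp [borderedColumns]
      have h2 := hS (N + 1) N.succ_pos
      rw [Matrix.trace] at h2
      simp only [diag_apply] at h2
      simp only [Fin.consEquiv, Equiv.coe_fn_mk]
      rw [Finset.sum_congr rfl fun x _ => h x, ← Finset.mul_sum, h2, mul_zero]
    have hb : ∀ b : Fin (N + 1), ∑ i : Fin (N + 1) → ι,
        (-1) ^ (b.succ : ℕ) * borderedColumns S Z q (Fin.cons l i) i 0 b.succ *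
          ((borderedColumns S Z q (Fin.cons l i) i).submatrix Fin.succ b.succ.succAbove).det =
        -((-1) ^ N * N.factorial * (S ^ (N + 1) * Z) l q) := by
      intro b
      rw [← (Fin.insertNthEquiv (fun _ => ι) b).sum_comp, Fintype.sum_prod_type]
      have h : ∀ (x : ι) (i : Fin N → ι),
          ((borderedColumns S Z q (Fin.cons l (b.insertNth x i : Fin (N + 1) → ι))
            (b.insertNth x i)).submatrix Fin.succ b.succ.succAbove).det =
          (-1) ^ (b : ℕ) * (borderedColumns S Z q (Fin.cons x i) i).det := by
        intro x i
        have : (-1 : C) ^ (b : ℕ) = ((Equiv.Perm.sign b.cycleRange : ℤˣ) : ℤ) := by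
          simp [Fin.sign_cycleRange]
        rw [this, ← det_permute]
        congr 1
        ext a c
        have hr : (Fin.cons x i : Fin (N + 1) → ι) (b.cycleRange a) =
            (b.insertNth x i : Fin (N + 1) → ι) a := by
          obtain ⟨a', rfl⟩ := b.cycleRange.symm.surjective a
          rw [Equiv.apply_symm_apply]
          refine Fin.cases ?_ (fun a'' => ?_) a' <;> simp
        refine Fin.cases ?_ (fun c' => ?_) c <;>
          simp [borderedColumns, hr]
      have h2 : ∀ (x : ι) (i : Fin N → ι),
          borderedColumns S Z q (Fin.cons l (b.insertNth x i : Fin (N + 1) → ι))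
            (b.insertNth x i) 0 b.succ = S l x := by
        intro x i
        simp [borderedColumns]
      simp only [Fin.insertNthEquiv, Equiv.coe_fn_mk]
      simp only [h, h2]
      have h3 : ∀ (x : ι) (i : Fin N → ι), (-1 : C) ^ (b.succ : ℕ) * S l x *
          ((-1) ^ (b : ℕ) * (borderedColumns S Z q (Fin.cons x i) i).det) =
          -(S l x * (borderedColumns S Z q (Fin.cons x i) i).det) := by
        intro x i
        have : (-1 : C) ^ (b : ℕ) * (-1) ^ (b : ℕ) = 1 := by
          rw [← mul_pow]; simp
        rw [Fin.val_succ, pow_succ]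
        linear_combination (-(S l x * (borderedColumns S Z q (Fin.cons x i) i).det)) * this
      simp only [h3, Finset.sum_neg_distrib, ← Finset.mul_sum, ih]
      rw [pow_succ' S, Matrix.mul_assoc, Matrix.mul_apply, Finset.mul_sum]
      congr 1
      exact Finset.sum_congr rfl fun x _ => by ring
    rw [Finset.sum_congr rfl fun i _ => det_succ_row_zero _, Finset.sum_comm,
      Fin.sum_univ_succ, Finset.sum_congr rfl fun b _ => hb b]
    have h0 : ∀ i : Fin (N + 1) → ι,
        (borderedColumns S Z q (Fin.cons l i) i).submatrix Fin.succ (Fin.succAbove 0) =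
          S.submatrix i i := by
      intro i
      ext a c
      simp [borderedColumns]
    have h1 : ∀ i : Fin (N + 1) → ι,
        borderedColumns S Z q (Fin.cons l i) i 0 0 = Z l q := by
      intro i
      simp [borderedColumns]
    simp only [h0, h1, ← Finset.mul_sum, hE]
    rw [Finset.sum_const, Finset.card_univ, Fintype.card_fin, Nat.factorial_succ, pow_succ]
    push_cast
    simp
    ring

/-- For `S = Y A` with `tr S = tr S² = … = 0`, the matrix `Sᴺ Y` in terms of minors of `Y` of size
`N + 1`. -/
theorem sum_minor_mul_prod (Y A : Matrix ι ι C) (hS : ∀ j, 0 < j → ((Y * A) ^ j).trace = 0) (N : ℕ)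
    (l q : ι) :
    ∑ i : Fin N → ι, ∑ j : Fin N → ι,
      (Y.submatrix (Fin.cons l i : Fin (N + 1) → ι) (Fin.cons q j : Fin (N + 1) → ι)).det *
        ∏ b, A (j b) (i b) = (-1) ^ N * N.factorial * ((Y * A) ^ N * Y) l q := by
  rw [← sum_det_borderedColumns _ hS]
  refine Finset.sum_congr rfl fun i _ => ?_
  -- multilinearity of the determinant in the columns `Y A(·, i b) = ∑ⱼ Y(·, j) A(j, i b)`
  simp_rw [det_apply', Finset.sum_mul]
  rw [Finset.sum_comm]
  refine Finset.sum_congr rfl fun π _ => ?_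
  simp only [Fin.prod_univ_succ, borderedColumns, of_apply, Fin.cons_zero, Fin.cons_succ,
    submatrix_apply, Matrix.mul_apply, Finset.prod_univ_sum, Fintype.piFinset_univ,
    Finset.prod_mul_distrib, Finset.mul_sum]
  exact Finset.sum_congr rfl fun j _ => by ring

end Powers

/-! ### Contraction of minors of a symmetric matrix with skew-symmetric forms -/

section Contraction

variable {ι : Type*} {C : Type*} [CommRing C] {M : Type*} [AddCommGroup M] [Module C M]

section Pairing

variable [Fintype ι] {σ : Type*} [Fintype σ] [DecidableEq σ]

/-- The contraction of the minors of `Y` with a tensor `F`: the first copy of `σ` indexes the row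
positions, the second one the column positions. -/
def minorPairing (Y : Matrix ι ι C) (F : (σ ⊕ σ → ι) → M) : M :=
  ∑ f, minorAt Y f • F f

theorem minorPairing_exchange {Y : Matrix ι ι C} (hY : Y.IsSymm) (F : (σ ⊕ σ → ι) → M) (b : σ) :
    minorPairing Y F =
      ∑ a, minorPairing Y fun f => F (f ∘ Equiv.swap (Sum.inl a) (Sum.inr b)) := by
  simp only [minorPairing]
  rw [Finset.sum_congr rfl fun f _ => by rw [minorAt_eq_sum_swap hY f b, Finset.sum_smul],
    Finset.sum_comm]
  refine Finset.sum_congr rfl fun a _ => ?_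
  rw [← (Equiv.arrowCongr (Equiv.swap (Sum.inl a) (Sum.inr b)) (Equiv.refl ι)).sum_comp]
  refine Finset.sum_congr rfl fun f _ => ?_
  have : (Equiv.arrowCongr (Equiv.swap (Sum.inl a) (Sum.inr b)) (Equiv.refl ι)) f =
      f ∘ Equiv.swap (Sum.inl a) (Sum.inr b) := by
    ext x; simp [Equiv.arrowCongr]
  rw [this, Function.comp_assoc]
  congr 2
  ext x
  simp

theorem minorPairing_comp_of_sign (Y : Matrix ι ι C) (F : (σ ⊕ σ → ι) → M)
    (e : Equiv.Perm (σ ⊕ σ)) (z : ℤ) (he : ∀ f, minorAt Y (f ∘ e.symm) = z * minorAt Y f) :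
    (minorPairing Y fun f => F (f ∘ e)) = z • minorPairing Y F := by
  simp only [minorPairing]
  rw [← (Equiv.arrowCongr e (Equiv.refl ι)).sum_comp, Finset.smul_sum]
  refine Finset.sum_congr rfl fun f _ => ?_
  have : (Equiv.arrowCongr e (Equiv.refl ι)) f = f ∘ e.symm := by
    ext x; simp [Equiv.arrowCongr]
  have h2 : (f ∘ e.symm) ∘ e = f := by
    ext x; simp
  rw [this, he, h2, mul_smul, Int.cast_smul_eq_zsmul]

theorem minorPairing_swap_inl (Y : Matrix ι ι C) (F : (σ ⊕ σ → ι) → M) {a b : σ} (h : a ≠ b) :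
    (minorPairing Y fun f => F (f ∘ Equiv.sumCongr (Equiv.swap a b) (Equiv.refl σ))) =
      -minorPairing Y F := by
  rw [minorPairing_comp_of_sign Y F _ (-1), neg_one_smul]
  intro f
  have := minorAt_comp_inl Y f (Equiv.swap a b)
  rw [Equiv.Perm.sign_swap h] at this
  simpa using this

theorem minorPairing_swap_inr (Y : Matrix ι ι C) (F : (σ ⊕ σ → ι) → M) {a b : σ} (h : a ≠ b) :
    (minorPairing Y fun f => F (f ∘ Equiv.sumCongr (Equiv.refl σ) (Equiv.swap a b))) =
      -minorPairing Y F := by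
  rw [minorPairing_comp_of_sign Y F _ (-1), neg_one_smul]
  intro f
  have := minorAt_comp_inr Y f (Equiv.swap a b)
  rw [Equiv.Perm.sign_swap h] at this
  simpa using this

theorem minorPairing_neg (Y : Matrix ι ι C) (F : (σ ⊕ σ → ι) → M) :
    (minorPairing Y fun f => -F f) = -minorPairing Y F := by
  simp [minorPairing]

theorem minorPairing_sum {α : Type*} (s : Finset α) (Y : Matrix ι ι C)
    (F : α → (σ ⊕ σ → ι) → M) :
    (minorPairing Y fun f => ∑ x ∈ s, F x f) = ∑ x ∈ s, minorPairing Y (F x) := by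
  simp only [minorPairing, Finset.smul_sum]
  rw [Finset.sum_comm]

end Pairing

/-- The index positions in the rows (and in the columns) of a minor of size `2n + 1`: `n` pairs and
one further position. -/
abbrev PairedSlots (n : ℕ) : Type := Option (Fin n × Bool)

variable {n : ℕ}

/-- The product of `A` on the two (column, row) pairs of indices in the `s`-th pair of positions. -/
def straightTerm (A : Matrix ι ι C) (f : PairedSlots n ⊕ PairedSlots n → ι) (s : Fin n) : C :=
  A (f (.inr (some (s, false)))) (f (.inl (some (s, false)))) *
    A (f (.inr (some (s, true)))) (f (.inl (some (s, true))))

/-- The product of `A` on the pair of column indices and on the pair of row indices in the `s`-th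
pair of positions. -/
def crossTerm (A : Matrix ι ι C) (f : PairedSlots n ⊕ PairedSlots n → ι) (s : Fin n) : C :=
  A (f (.inr (some (s, false)))) (f (.inr (some (s, true)))) *
    A (f (.inl (some (s, false)))) (f (.inl (some (s, true))))

/-- The tensor with a factor `crossTerm` for the pairs in `P`, a factor `straightTerm` for the other
pairs, and `g` in the last position. -/
def mixedTensor (A : Matrix ι ι C) (g : Matrix ι ι M) (P : Finset (Fin n))
    (f : PairedSlots n ⊕ PairedSlots n → ι) : M :=
  (∏ s, if s ∈ P then crossTerm A f s else straightTerm A f s) • g (f (.inr none)) (f (.inl none))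

theorem Finset.prod_univ_eq_mul_mul_erase {α : Type*} [Fintype α] [DecidableEq α] {a b : α}
    (h : a ≠ b) (t : α → C) :
    ∏ s, t s = t a * t b * ∏ s ∈ (Finset.univ.erase a).erase b, t s := by
  rw [mul_assoc, Finset.mul_prod_erase _ _ (by simp [h.symm]),
    Finset.mul_prod_erase _ _ (Finset.mem_univ a)]

theorem mixedTensor_swap_self_false {A : Matrix ι ι C} (hA : Aᵀ = -A) (g : Matrix ι ι M)
    {P : Finset (Fin n)} {s₀ : Fin n} (h₀ : s₀ ∉ P) (f : PairedSlots n ⊕ PairedSlots n → ι) :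
    mixedTensor A g P (f ∘ Equiv.swap (.inl (some (s₀, false))) (.inr (some (s₀, false)))) =
      -mixedTensor A g P f := by
  have hA' : ∀ i j, A i j = -A j i := fun i j => congrFun (congrFun hA j) i
  rw [mixedTensor, mixedTensor, ← neg_smul]
  congr 1
  · rw [← Finset.mul_prod_erase _ _ (Finset.mem_univ s₀),
      ← Finset.mul_prod_erase _ _ (Finset.mem_univ s₀), ← neg_mul]
    congr 1
    · simp only [h₀, if_false, straightTerm, Function.comp, Equiv.swap_apply_def]
      simp
      rw [hA' (f (.inl (some (s₀, false)))), neg_mul]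
    · refine Finset.prod_congr rfl fun s hs => ?_
      have hs' : s ≠ s₀ := Finset.ne_of_mem_erase hs
      simp [straightTerm, crossTerm, Equiv.swap_apply_def, hs']

theorem mixedTensor_swap_self_true {A : Matrix ι ι C} (hA : Aᵀ = -A) (g : Matrix ι ι M)
    {P : Finset (Fin n)} {s₀ : Fin n} (h₀ : s₀ ∉ P) (f : PairedSlots n ⊕ PairedSlots n → ι) :
    mixedTensor A g P (f ∘ Equiv.swap (.inl (some (s₀, true))) (.inr (some (s₀, false)))) =
      mixedTensor A g (insert s₀ P) f := by
  have hA' : ∀ i j, A i j = -A j i := fun i j => congrFun (congrFun hA j) i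
  rw [mixedTensor, mixedTensor]
  congr 1
  rw [← Finset.mul_prod_erase _ _ (Finset.mem_univ s₀),
    ← Finset.mul_prod_erase _ _ (Finset.mem_univ s₀)]
  congr 1
  · simp only [h₀, if_false, straightTerm, crossTerm, Function.comp, Equiv.swap_apply_def]
    simp
    rw [hA' (f (.inl (some (s₀, true)))), hA' (f (.inr (some (s₀, true))))]
    ring
  · refine Finset.prod_congr rfl fun s hs => ?_
    have hs' : s ≠ s₀ := Finset.ne_of_mem_erase hs
    simp [straightTerm, crossTerm, Equiv.swap_apply_def, hs']

/-- An exchange between two pairs outside `P` crosses one of them, up to the simultaneous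
transposition of two rows and of the two corresponding columns. -/
theorem mixedTensor_swap_of_notMem {A : Matrix ι ι C} (hA : Aᵀ = -A) (g : Matrix ι ι M)
    {P : Finset (Fin n)} {s₀ s₁ : Fin n} (h₀ : s₀ ∉ P) (h₁ : s₁ ∉ P) (h : s₀ ≠ s₁) (x : Bool)
    (f : PairedSlots n ⊕ PairedSlots n → ι) :
    mixedTensor A g P (f ∘ Equiv.swap (.inl (some (s₁, x))) (.inr (some (s₀, false)))) =
      mixedTensor A g (insert s₀ P)
        ((f ∘ Equiv.sumCongr (Equiv.swap (some (s₀, true)) (some (s₁, x))) (Equiv.refl _)) ∘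
          Equiv.sumCongr (Equiv.refl _) (Equiv.swap (some (s₀, true)) (some (s₁, x)))) := by
  have hA' : ∀ i j, A i j = -A j i := fun i j => congrFun (congrFun hA j) i
  rw [mixedTensor, mixedTensor]
  congr 1
  rw [Finset.prod_univ_eq_mul_mul_erase h, Finset.prod_univ_eq_mul_mul_erase h]
  congr 1
  · cases x
    · simp [h₀, h₁, h, h.symm, straightTerm, crossTerm, Equiv.swap_apply_def]
      rw [hA' (f (.inl (some (s₁, false)))), hA' (f (.inr (some (s₁, false))))]
      ring
    · simp [h₀, h₁, h, h.symm, straightTerm, crossTerm, Equiv.swap_apply_def]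
      rw [hA' (f (.inl (some (s₁, true)))), hA' (f (.inr (some (s₁, true))))]
      ring
  · refine Finset.prod_congr rfl fun s hs => ?_
    have hs' : s ≠ s₁ ∧ s ≠ s₀ := by simpa using hs
    simp [straightTerm, crossTerm, Equiv.swap_apply_def, hs'.1, hs'.2]

/-- An exchange between a pair outside `P` and a pair in `P` amounts to a transposition of rows. -/
theorem mixedTensor_swap_of_mem {A : Matrix ι ι C} (hA : Aᵀ = -A) (g : Matrix ι ι M)
    {P : Finset (Fin n)} {s₀ s₁ : Fin n} (h₀ : s₀ ∉ P) (h₁ : s₁ ∈ P) (x : Bool)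
    (f : PairedSlots n ⊕ PairedSlots n → ι) :
    mixedTensor A g P (f ∘ Equiv.swap (.inl (some (s₁, x))) (.inr (some (s₀, false)))) =
      mixedTensor A g P
        (f ∘ Equiv.sumCongr (Equiv.swap (some (s₀, false)) (some (s₁, !x))) (Equiv.refl _)) := by
  have hA' : ∀ i j, A i j = -A j i := fun i j => congrFun (congrFun hA j) i
  have h : s₀ ≠ s₁ := fun h => h₀ (h ▸ h₁)
  rw [mixedTensor, mixedTensor]
  congr 1
  rw [Finset.prod_univ_eq_mul_mul_erase h, Finset.prod_univ_eq_mul_mul_erase h]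
  congr 1
  · cases x
    · simp [h₀, h₁, h, h.symm, straightTerm, crossTerm, Equiv.swap_apply_def]
      rw [hA' (f (.inl (some (s₁, false))))]
      ring
    · simp [h₀, h₁, h, h.symm, straightTerm, crossTerm, Equiv.swap_apply_def]
      rw [hA' (f (.inl (some (s₁, true)))), hA' (f (.inl (some (s₁, false))))]
      ring
  · refine Finset.prod_congr rfl fun s hs => ?_
    have hs' : s ≠ s₁ ∧ s ≠ s₀ := by simpa using hs
    simp [straightTerm, crossTerm, Equiv.swap_apply_def, hs'.1, hs'.2]

/-- As `g` is symmetric, after the exchange of the unpaired row with a column the tensor is invariant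
under a transposition of columns, so that its contraction vanishes. -/
theorem mixedTensor_swap_none (A : Matrix ι ι C) {g : Matrix ι ι M} (hg : g.IsSymm)
    {P : Finset (Fin n)} {s₀ : Fin n} (h₀ : s₀ ∉ P) (f : PairedSlots n ⊕ PairedSlots n → ι) :
    mixedTensor A g P (f ∘ Equiv.swap (.inl none) (.inr (some (s₀, false)))) =
      mixedTensor A g P ((f ∘ Equiv.sumCongr (Equiv.refl _)
          (Equiv.swap none (some (s₀, false)))) ∘
        Equiv.swap (.inl none) (.inr (some (s₀, false)))) := by
  rw [mixedTensor, mixedTensor]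
  congr 1
  · refine Finset.prod_congr rfl fun s _ => ?_
    by_cases hs : s = s₀
    · subst hs
      simp [h₀, straightTerm, Equiv.swap_apply_def]
    · simp [straightTerm, crossTerm, Equiv.swap_apply_def, hs]
  · simp [Equiv.swap_apply_def, hg.apply]

section

variable [Fintype ι] [Module ℚ M]

/-- The exchange relation for the first column position of the pair `s₀`, summed up: it compares
the contractions with a straight and with a crossed pair `s₀`. -/
theorem minorPairing_mixedTensor_insert {Y A : Matrix ι ι C} (hY : Y.IsSymm) (hA : Aᵀ = -A)
    {g : Matrix ι ι M} (hg : g.IsSymm) {P : Finset (Fin n)} {s₀ : Fin n} (h₀ : s₀ ∉ P) :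
    (2 + 2 * P.card : ℚ) • minorPairing Y (mixedTensor A g P) =
      (2 * (n - P.card) - 1 : ℚ) • minorPairing Y (mixedTensor A g (insert s₀ P)) := by
  set E := minorPairing Y (mixedTensor A g P) with hE
  set E' := minorPairing Y (mixedTensor A g (insert s₀ P)) with hE'
  -- the terms of the exchange relation
  set G : PairedSlots n → M := fun a => minorPairing Y fun f =>
    mixedTensor A g P (f ∘ Equiv.swap (.inl a) (.inr (some (s₀, false)))) with hG
  -- for the unpaired row, `g` receives two column indices: symmetric against antisymmetric
  have hnone : G none = 0 := by
    have h := minorPairing_swap_inr Y (fun f =>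
      mixedTensor A g P (f ∘ Equiv.swap (.inl none) (.inr (some (s₀, false)))))
      (a := none) (b := some (s₀, false)) (by simp)
    simp only [← mixedTensor_swap_none A hg h₀] at h
    have h2 : (2 : ℚ) • G none = 0 := by
      rw [two_smul]
      exact eq_neg_iff_add_eq_zero.mp h
    exact (IsUnit.mk0 (2 : ℚ) two_ne_zero).smul_eq_zero.mp h2
  have hpair : ∀ s, G (some (s, true)) + G (some (s, false)) =
      (if s ∈ P then (-2 : ℚ) • E else (2 : ℚ) • E') + if s = s₀ then -E - E' else 0 := by
    intro s
    by_cases hs : s = s₀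
    · subst hs
      have h1 : G (some (s, true)) = E' := by
        simp only [hG, mixedTensor_swap_self_true hA g h₀]; rfl
      have h2 : G (some (s, false)) = -E := by
        simp only [hG, mixedTensor_swap_self_false hA g h₀, minorPairing_neg]; rfl
      rw [h1, h2, if_neg h₀, if_pos rfl]
      module
    · rw [if_neg hs, add_zero]
      split_ifs with hP
      · have h1 : ∀ x, G (some (s, x)) = -E := by
          intro x
          simp only [hG, mixedTensor_swap_of_mem hA g h₀ hP]
          exact minorPairing_swap_inl Y (mixedTensor A g P) (by simp [Ne.symm hs])
        rw [h1, h1]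
        module
      · have h1 : ∀ x, G (some (s, x)) = E' := by
          intro x
          simp only [hG, mixedTensor_swap_of_notMem hA g h₀ hP (Ne.symm hs)]
          rw [minorPairing_swap_inl Y (fun f => mixedTensor A g (insert s₀ P) (f ∘
            Equiv.sumCongr (Equiv.refl _) (Equiv.swap (some (s₀, true)) (some (s, x)))))
            (by simp [Ne.symm hs]),
            minorPairing_swap_inr Y _ (by simp [Ne.symm hs]), neg_neg]
        rw [h1, h1]
        module
  have hsum : E = ∑ a, G a := minorPairing_exchange hY _ (some (s₀, false))
  rw [Fintype.sum_option, hnone, zero_add, Fintype.sum_prod_type] at hsum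
  simp only [Fintype.sum_bool, hpair] at hsum
  rw [Finset.sum_add_distrib, Finset.sum_ite_eq' Finset.univ s₀, if_pos (Finset.mem_univ _),
    Finset.sum_ite, Finset.sum_const, Finset.sum_const, Finset.filter_mem_eq_inter,
    Finset.univ_inter, Finset.filter_not, Finset.filter_mem_eq_inter, Finset.univ_inter,
    Finset.card_sdiff_of_subset (Finset.subset_univ _), Finset.card_univ, Fintype.card_fin,
    ← Nat.cast_smul_eq_nsmul ℚ, ← Nat.cast_smul_eq_nsmul ℚ,
    Nat.cast_sub (by simpa using Finset.card_le_univ P)] at hsum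
  have h2 : (2 + 2 * P.card : ℚ) • E - (2 * (n - P.card) - 1 : ℚ) • E' =
      E - ((P.card : ℚ) • (-2 : ℚ) • E + ((n : ℚ) - P.card) • (2 : ℚ) • E' + (-E - E')) := by
    module
  rw [← sub_eq_zero, h2, sub_eq_zero]
  exact hsum

/-- By `minorPairing_mixedTensor`, the ratio between the contractions with `p` crossed pairs
and with none. -/
def crossWeight (n p : ℕ) : ℚ :=
  ∏ t ∈ Finset.range p, (2 + 2 * t : ℚ) / (2 * (n - t) - 1)

theorem crossWeight_pos {n p : ℕ} (h : p ≤ n) : 0 < crossWeight n p := by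
  refine Finset.prod_pos fun t ht => div_pos (by positivity) ?_
  have : (t : ℚ) + 1 ≤ n := by
    have := Finset.mem_range.mp ht
    exact_mod_cast (by omega : t + 1 ≤ n)
  linarith

theorem minorPairing_mixedTensor {Y A : Matrix ι ι C} (hY : Y.IsSymm) (hA : Aᵀ = -A)
    {g : Matrix ι ι M} (hg : g.IsSymm) (P : Finset (Fin n)) :
    minorPairing Y (mixedTensor A g P) =
      crossWeight n P.card • minorPairing Y (mixedTensor (n := n) A g ∅) := by
  induction P using Finset.induction_on with
  | empty => simp [crossWeight]
  | insert s P hs ih =>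
    have h := minorPairing_mixedTensor_insert hY hA hg hs
    have hpos : (0 : ℚ) < 2 * (n - P.card) - 1 := by
      have h1 : (insert s P).card ≤ n := by simpa using Finset.card_le_univ (insert s P)
      rw [Finset.card_insert_of_notMem hs] at h1
      have : (P.card : ℚ) + 1 ≤ n := by exact_mod_cast h1
      linarith
    rw [ih, smul_smul] at h
    rw [Finset.card_insert_of_notMem hs, crossWeight, Finset.prod_range_succ, ← crossWeight,
      ← inv_smul_smul₀ hpos.ne' (minorPairing Y (mixedTensor A g (insert s P))), ← h, smul_smul]
    congr 1
    ring

/-- The sum over all sets of crossed pairs of the ratios `crossWeight`. -/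
def totalCrossWeight (n : ℕ) : ℚ :=
  ∑ P : Finset (Fin n), crossWeight n P.card

theorem totalCrossWeight_pos (n : ℕ) : 0 < totalCrossWeight n :=
  Finset.sum_pos (fun P _ => crossWeight_pos (by simpa using Finset.card_le_univ P))
    Finset.univ_nonempty

/-- In the contraction with no crossed pair, the product of two values of `A` at each pair may be
replaced by the sum of its straight and its crossed version, at the cost of a positive factor. For
`A = dX Y dX` this sum involves only minors of `Y` of size two. -/
theorem minorPairing_prod_add {Y A : Matrix ι ι C} (hY : Y.IsSymm) (hA : Aᵀ = -A)
    {g : Matrix ι ι M} (hg : g.IsSymm) :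
    (minorPairing Y fun f : PairedSlots n ⊕ PairedSlots n → ι =>
      (∏ s, (straightTerm A f s + crossTerm A f s)) • g (f (.inr none)) (f (.inl none))) =
      totalCrossWeight n • minorPairing Y (mixedTensor (n := n) A g ∅) := by
  have h : ∀ f : PairedSlots n ⊕ PairedSlots n → ι,
      (∏ s, (straightTerm A f s + crossTerm A f s)) • g (f (.inr none)) (f (.inl none)) =
        ∑ P, mixedTensor A g P f := by
    intro f
    simp only [mixedTensor, ← Finset.sum_smul]
    congr 1
    simp only [add_comm (straightTerm A f _)]
    rw [Finset.prod_add, Finset.powerset_univ]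
    refine Finset.sum_congr rfl fun P _ => ?_
    rw [Finset.prod_ite, Finset.filter_mem_eq_inter, Finset.univ_inter, Finset.filter_not,
      Finset.filter_mem_eq_inter, Finset.univ_inter]
  simp only [h]
  rw [minorPairing_sum, totalCrossWeight, Finset.sum_smul]
  exact Finset.sum_congr rfl fun P _ => minorPairing_mixedTensor hY hA hg P

variable [DecidableEq ι]

/-- A bijection of the positions `Fin (2n + 1)` with `PairedSlots n` sending `0` to the unpaired
position. -/
def slotEquiv (n : ℕ) : Fin (n * 2 + 1) ≃ PairedSlots n :=
  (_root_.finSuccEquiv (n * 2)).trans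
    ((finProdFinEquiv.symm.trans (Equiv.prodCongr (Equiv.refl _) finTwoEquiv)).optionCongr)

/-- With no crossed pair the contraction is `tr ((YA)²ⁿ Y g)`, up to a factor. -/
theorem minorPairing_mixedTensor_empty {Y A : Matrix ι ι C}
    (hS : ∀ j, 0 < j → ((Y * A) ^ j).trace = 0) (g : Matrix ι ι M) :
    minorPairing Y (mixedTensor (n := n) A g ∅) =
      ((n * 2).factorial : ℚ) • ∑ l, ∑ q, ((Y * A) ^ (n * 2) * Y) l q • g q l := by
  have hsum : ∀ φ : (PairedSlots n ⊕ PairedSlots n → ι) → M, ∑ f, φ f =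
      ∑ l, ∑ i : Fin (n * 2) → ι, ∑ q, ∑ j : Fin (n * 2) → ι,
        φ (Sum.elim ((Fin.cons l i : Fin (n * 2 + 1) → ι) ∘ (slotEquiv n).symm)
          ((Fin.cons q j : Fin (n * 2 + 1) → ι) ∘ (slotEquiv n).symm)) := by
    intro φ
    have hone : ∀ ψ : (PairedSlots n → ι) → M, ∑ r, ψ r =
        ∑ l, ∑ i : Fin (n * 2) → ι,
          ψ ((Fin.cons l i : Fin (n * 2 + 1) → ι) ∘ (slotEquiv n).symm) := by
      intro ψ
      rw [← (Equiv.arrowCongr (slotEquiv n) (Equiv.refl ι)).sum_comp,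
        ← (Fin.consEquiv fun _ => ι).sum_comp, Fintype.sum_prod_type]
      rfl
    rw [← (Equiv.sumArrowEquivProdArrow _ _ ι).symm.sum_comp, Fintype.sum_prod_type, hone]
    refine Finset.sum_congr rfl fun l _ => Finset.sum_congr rfl fun i _ => ?_
    rw [hone]
    rfl
  rw [minorPairing, hsum, Finset.smul_sum]
  refine Finset.sum_congr rfl fun l _ => ?_
  rw [Finset.sum_comm, Finset.smul_sum]
  refine Finset.sum_congr rfl fun q _ => ?_
  have h := sum_minor_mul_prod Y A hS (n * 2) l q
  rw [(even_two.mul_left n).neg_one_pow, one_mul] at h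
  rw [Nat.cast_smul_eq_nsmul ℚ, ← Nat.cast_smul_eq_nsmul C, smul_smul, ← h, Finset.sum_smul]
  refine Finset.sum_congr rfl fun i _ => ?_
  rw [Finset.sum_smul]
  refine Finset.sum_congr rfl fun j _ => ?_
  rw [mixedTensor, smul_smul]
  congr 2
  · rw [minorAt, Sum.elim_comp_inl, Sum.elim_comp_inr]
    exact det_submatrix_equiv_self (slotEquiv n).symm
      (Y.submatrix (Fin.cons l i : Fin (n * 2 + 1) → ι) (Fin.cons q j : Fin (n * 2 + 1) → ι))
  · rw [← (finProdFinEquiv.symm.trans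
      (Equiv.prodCongr (Equiv.refl (Fin n)) finTwoEquiv)).symm.prod_comp, Fintype.prod_prod_type]
    refine Finset.prod_congr rfl fun s _ => ?_
    refine Eq.trans ?_ (Eq.trans (mul_comm _ _) (Fintype.prod_bool _).symm)
    rfl

end

end Contraction

/-! ### The logarithmic derivative of the determinant -/

section Jacobi

variable {A : Type*} [CommRing A] [Algebra ℚ A] {R : Type*} [Ring R] [Algebra ℚ R] [Algebra A R]

theorem Derivation.map_finset_prod {α : Type*} [DecidableEq α] (d : Derivation ℚ A R)
    (s : Finset α) (x : α → A) :
    d (∏ i ∈ s, x i) = ∑ i ∈ s, (∏ j ∈ s.erase i, x j) • d (x i) := by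
  induction s using Finset.induction_on with
  | empty => simp
  | insert a s ha ih =>
    rw [Finset.prod_insert ha, Derivation.leibniz, ih, Finset.sum_insert ha,
      Finset.erase_insert ha, Finset.smul_sum, add_comm]
    congr 1
    refine Finset.sum_congr rfl fun i hi => ?_
    have : a ≠ i := fun h => ha (h ▸ hi)
    rw [Finset.erase_insert_of_ne this, Finset.prod_insert (by simp [ha]), smul_smul]

/-- Jacobi's formula for the derivative of a determinant. -/
theorem Derivation.map_det {ι : Type*} [Fintype ι] [DecidableEq ι] (d : Derivation ℚ A R)
    (X : Matrix ι ι A) : d X.det = ∑ i, ∑ j, adjugate X i j • d (X j i) := by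
  have hadj : ∀ i j, adjugate X i j = ∑ π : Equiv.Perm ι, ((Equiv.Perm.sign π : ℤ) : A) *
      if π i = j then ∏ c ∈ Finset.univ.erase i, X (π c) c else 0 := by
    intro i j
    rw [← transpose_apply (adjugate X), adjugate_transpose, adjugate_apply, ← det_transpose,
      updateRow_transpose, transpose_transpose, det_apply']
    refine Finset.sum_congr rfl fun π _ => ?_
    rw [← Finset.mul_prod_erase _ _ (Finset.mem_univ i)]
    congr 1
    rw [updateCol_self, Pi.single_apply, ite_mul, one_mul, zero_mul]
    congr 1
    refine Finset.prod_congr rfl fun c hc => ?_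
    rw [updateCol_ne (Finset.ne_of_mem_erase hc)]
  rw [det_apply', map_sum]
  simp only [hadj, Finset.sum_smul]
  rw [Finset.sum_congr rfl fun i _ => Finset.sum_comm, Finset.sum_comm]
  refine Finset.sum_congr rfl fun π _ => ?_
  rw [Derivation.leibniz, Derivation.map_intCast, smul_zero, add_zero, Derivation.map_finset_prod,
    Finset.smul_sum]
  refine Finset.sum_congr rfl fun i _ => ?_
  simp [mul_smul, ite_smul]

theorem invariantTrace_one (d : Derivation ℚ A R) {k : ℕ} (X : GL (Fin k) A) :
    invariantTrace d X 1 = dlog d (GeneralLinearGroup.det X) := by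
  rw [invariantTrace, pow_one, dlog, GeneralLinearGroup.val_det_apply, Derivation.map_det,
    Matrix.trace, Finset.smul_sum]
  refine Finset.sum_congr rfl fun i _ => ?_
  rw [diag_apply, Matrix.mul_apply, Finset.smul_sum]
  refine Finset.sum_congr rfl fun j _ => ?_
  rw [map_apply, map_apply, ← Algebra.smul_def, val_inv_eq_smul_adjugate,
    Matrix.smul_apply, smul_assoc]

end Jacobi

/-! ### Even forms -/

section Even

variable {A : Type*} [CommRing A] [Algebra ℚ A] {R : Type*} [Ring R] [Algebra ℚ R] [Algebra A R]

/-- The products `da db` generate a commutative subalgebra, and its elements commute with all the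
one-forms `da`. -/
theorem exists_evenForms {R : Type u} [Ring R] [Algebra ℚ R] [Algebra A R]
    (d : Derivation ℚ A R) (hd : ∀ a b, d a * d b = -(d b * d a)) :
    ∃ (C : Type u) (_ : CommRing C) (_ : Algebra A C) (ψ : C →ₐ[A] R) (E : A → A → C),
      Function.Injective ψ ∧ (∀ c a, ψ c * d a = d a * ψ c) ∧ ∀ a b, ψ (E a b) = d a * d b := by
  set s : Set R := Set.range fun p : A × A => d p.1 * d p.2 with hs
  have h1 : ∀ x ∈ s, ∀ a, x * d a = d a * x := by
    rintro _ ⟨⟨b, c⟩, rfl⟩ a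
    simp only
    rw [mul_assoc, hd c a, mul_neg, ← mul_assoc, hd b a, neg_mul, neg_neg, mul_assoc]
  have h2 : ∀ x ∈ s, ∀ y ∈ s, x * y = y * x := by
    rintro x hx _ ⟨⟨b, c⟩, rfl⟩
    simp only
    rw [← mul_assoc, h1 x hx, mul_assoc, h1 x hx, mul_assoc]
  have hcomm := Algebra.isMulCommutative_adjoin A h2
  let _ : CommRing (Algebra.adjoin A s) :=
    { (Algebra.adjoin A s).toRing with mul_comm := hcomm.is_comm.comm }
  refine ⟨Algebra.adjoin A s, inferInstance, inferInstance, (Algebra.adjoin A s).val,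
    fun a b => ⟨d a * d b, Algebra.subset_adjoin ⟨(a, b), rfl⟩⟩, Subtype.val_injective, ?_,
    fun a b => rfl⟩
  rintro ⟨c, hc⟩ a
  change c * d a = d a * c
  induction hc using Algebra.adjoin_induction with
  | mem x hx => exact h1 x hx a
  | algebraMap r => exact Algebra.commutes r _
  | add x y _ _ hx hy => rw [add_mul, mul_add, hx, hy]
  | mul x y _ _ hx hy => rw [mul_assoc, hy, ← mul_assoc, hx, mul_assoc]

variable {C : Type*} [CommRing C] [Algebra A C]

/-- The matrix `dX Y dX` of two-forms, in a commutative algebra `C` where `E a b` stands for the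
product `da db`. -/
def evenMatrix {k : ℕ} (E : A → A → C) (X Y : Matrix (Fin k) (Fin k) A) :
    Matrix (Fin k) (Fin k) C :=
  Matrix.of fun i j => ∑ a, ∑ b, Y a b • E (X i a) (X b j)

variable {d : Derivation ℚ A R} {ψ : C →ₐ[A] R} {E : A → A → C}

theorem map_evenMatrix (hE : ∀ a b, ψ (E a b) = d a * d b) {k : ℕ}
    (X Y : Matrix (Fin k) (Fin k) A) :
    (evenMatrix E X Y).map ψ = X.map d * Y.map (algebraMap A R) * X.map d := by
  ext i j
  simp only [evenMatrix, map_apply, of_apply, map_sum, map_smul, hE, Matrix.mul_apply,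
    Finset.sum_mul]
  rw [Finset.sum_comm]
  refine Finset.sum_congr rfl fun b _ => Finset.sum_congr rfl fun a _ => ?_
  rw [← Algebra.commutes, ← Algebra.smul_def, smul_mul_assoc]

theorem map_pow_evenMatrix (hE : ∀ a b, ψ (E a b) = d a * d b) {k : ℕ}
    (X Y : Matrix (Fin k) (Fin k) A) (n : ℕ) :
    ((Y.map (algebraMap A C) * evenMatrix E X Y) ^ n).map ψ =
      (Y.map (algebraMap A R) * X.map d) ^ (2 * n) := by
  have h : (Y.map (algebraMap A C) * evenMatrix E X Y).map ψ =
      (Y.map (algebraMap A R) * X.map d) ^ 2 := by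
    rw [Matrix.map_mul, map_evenMatrix hE, pow_two, Matrix.map_map, ← Matrix.mul_assoc,
      ← Matrix.mul_assoc, ← Matrix.mul_assoc]
    congr 4
    ext x
    simp
  rw [pow_mul, ← h]
  exact map_pow ψ.mapMatrix _ n

/-- The even powers of `Y dX` have trace zero, because its entries anticommute. -/
theorem trace_pow_evenMatrix (hd : ∀ a b, d a * d b = -(d b * d a)) (hψ : Function.Injective ψ)
    (hc : ∀ c a, ψ c * d a = d a * ψ c) (hE : ∀ a b, ψ (E a b) = d a * d b) {k : ℕ}
    (X Y : Matrix (Fin k) (Fin k) A) (n : ℕ) (hn : 0 < n) :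
    ((Y.map (algebraMap A C) * evenMatrix E X Y) ^ n).trace = 0 := by
  apply hψ
  obtain ⟨n, rfl⟩ := Nat.exists_eq_succ_of_ne_zero hn.ne'
  set ω := Y.map (algebraMap A R) * X.map d with hω
  set T := (Y.map (algebraMap A C) * evenMatrix E X Y) ^ n with hT
  have hdω : ∀ a i j, d a * ω i j = -(ω i j * d a) := by
    intro a i j
    rw [hω, Matrix.mul_apply, Finset.mul_sum, Finset.sum_mul, ← Finset.sum_neg_distrib]
    refine Finset.sum_congr rfl fun c _ => ?_
    rw [map_apply, map_apply, ← mul_assoc, ← Algebra.commutes, mul_assoc, hd, mul_neg, mul_assoc]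
  have hωω : ∀ i j i' j', ω i j * ω i' j' = -(ω i' j' * ω i j) := by
    intro i j i' j'
    have h : ω i j = ∑ c, algebraMap A R (Y i c) * d (X c j) := by
      rw [hω, Matrix.mul_apply]
      rfl
    rw [h, Finset.mul_sum, Finset.sum_mul, ← Finset.sum_neg_distrib]
    refine Finset.sum_congr rfl fun c _ => ?_
    rw [mul_assoc, hdω, mul_neg, ← mul_assoc, Algebra.commutes, mul_assoc]
  have hcω : ∀ c i j, ψ c * ω i j = ω i j * ψ c := by
    intro c i j
    rw [hω, Matrix.mul_apply, Finset.mul_sum, Finset.sum_mul]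
    refine Finset.sum_congr rfl fun b _ => ?_
    rw [map_apply, map_apply, ← mul_assoc, ← Algebra.commutes, mul_assoc, hc, mul_assoc]
  have h1 : ψ ((Y.map (algebraMap A C) * evenMatrix E X Y) ^ (n + 1)).trace =
      ∑ a, ∑ b, ∑ c, ω a b * ω b c * ψ (T c a) := by
    have h2 : (ω ^ (2 * (n + 1))).trace = ∑ a, ∑ b, ∑ c, ω a b * ω b c * ψ (T c a) := by
      have : ω ^ (2 * (n + 1)) = ω * (ω * T.map ψ) := by
        rw [hT, map_pow_evenMatrix hE, ← hω, mul_add, mul_one, add_comm, pow_add, pow_two,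
          Matrix.mul_assoc]
      rw [this, Matrix.trace]
      refine Finset.sum_congr rfl fun a _ => ?_
      rw [diag_apply, Matrix.mul_apply]
      refine Finset.sum_congr rfl fun b _ => ?_
      rw [Matrix.mul_apply, Finset.mul_sum]
      exact Finset.sum_congr rfl fun c _ => by rw [map_apply, mul_assoc]
    rw [← h2, ← map_pow_evenMatrix hE]
    simp [Matrix.trace]
  have h3 : ψ ((Y.map (algebraMap A C) * evenMatrix E X Y) ^ (n + 1)).trace =
      ∑ a, ∑ b, ∑ c, ω b c * ω a b * ψ (T c a) := by
    have h2 : (ω ^ (2 * (n + 1))).trace = ∑ b, ∑ c, ∑ a, ω b c * ω a b * ψ (T c a) := by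
      have : ω ^ (2 * (n + 1)) = ω * (T.map ψ * ω) := by
        rw [hT, map_pow_evenMatrix hE, ← hω, mul_add, mul_one, ← pow_succ, ← pow_succ']
      rw [this, Matrix.trace]
      refine Finset.sum_congr rfl fun a _ => ?_
      rw [diag_apply, Matrix.mul_apply]
      refine Finset.sum_congr rfl fun b _ => ?_
      rw [Matrix.mul_apply, Finset.mul_sum]
      exact Finset.sum_congr rfl fun c _ => by rw [map_apply, hcω, mul_assoc]
    rw [Finset.sum_comm, Finset.sum_congr rfl fun b _ => Finset.sum_comm, ← h2,
      ← map_pow_evenMatrix hE]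
    simp [Matrix.trace]
  -- the two expansions differ by exchanging a pair of one-forms
  have h4 : ψ ((Y.map (algebraMap A C) * evenMatrix E X Y) ^ (n + 1)).trace =
      -ψ ((Y.map (algebraMap A C) * evenMatrix E X Y) ^ (n + 1)).trace := by
    nth_rewrite 1 [h1]
    rw [h3]
    simp only [← Finset.sum_neg_distrib]
    refine Finset.sum_congr rfl fun a _ => Finset.sum_congr rfl fun b _ =>
      Finset.sum_congr rfl fun c _ => ?_
    rw [hωω, neg_mul]
  rw [map_zero]
  refine (IsUnit.mk0 (2 : ℚ) two_ne_zero).smul_eq_zero.mp ?_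
  rw [two_smul]
  exact eq_neg_iff_add_eq_zero.mp h4

theorem invariantTrace_odd (hE : ∀ a b, ψ (E a b) = d a * d b) {k : ℕ} (X : GL (Fin k) A) (n : ℕ) :
    invariantTrace d X (2 * n + 1) = ∑ l, ∑ q,
      ψ (((((X⁻¹).val.map (algebraMap A C) * evenMatrix E X.val (X⁻¹).val) ^ n) *
        (X⁻¹).val.map (algebraMap A C)) l q) * d (X.val q l) := by
  have h : ((((X⁻¹).val.map (algebraMap A C) * evenMatrix E X.val (X⁻¹).val) ^ n) *
      (X⁻¹).val.map (algebraMap A C)).map ψ =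
      ((X⁻¹).val.map (algebraMap A R) * X.val.map d) ^ (2 * n) *
        (X⁻¹).val.map (algebraMap A R) := by
    rw [Matrix.map_mul, map_pow_evenMatrix hE, Matrix.map_map]
    congr 2
    ext x
    simp
  rw [invariantTrace, pow_succ, ← Matrix.mul_assoc, ← h, Matrix.trace]
  exact Finset.sum_congr rfl fun l _ => Matrix.mul_apply

end Even

/-! ### The numerators of the invariant traces -/

section Numerators

theorem List.prod_ofFn_smul {A : Type*} [CommRing A] {R : Type*} [Ring R] [Algebra A R]
    (n : ℕ) (u : A) (x : Fin n → R) :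
    (List.ofFn fun i => u • x i).prod = u ^ n • (List.ofFn x).prod := by
  induction n with
  | zero => simp
  | succ n ih =>
    rw [List.ofFn_succ, List.ofFn_succ, List.prod_cons, List.prod_cons, ih, smul_mul_smul_comm,
      pow_succ']

variable {A : Type*} [CommRing A] [Algebra ℚ A] {R : Type*} [Ring R] [Algebra ℚ R] [Algebra A R]
  {k : ℕ}

/-- The entries of `dX Z dX`. -/
def twoForm (d : Derivation ℚ A R) (X Z : Matrix (Fin k) (Fin k) A) (i j : Fin k) : R :=
  ∑ a, ∑ b, Z a b • (d (X i a) * d (X b j))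

/-- The form `det(X)^{n+1} β^{2n+1}_X`, as a polynomial in the entries of `X` and `dX`. -/
def traceNumerator (d : Derivation ℚ A R) (X : Matrix (Fin k) (Fin k) A) (n : ℕ) : R :=
  ((-1) ^ n * n.factorial : ℚ)⁻¹ • ∑ l, ∑ q, ∑ i : Fin n → Fin k, ∑ j : Fin n → Fin k,
    borderedMinor X (Fin.cons l i : Fin (n + 1) → Fin k) (Fin.cons q j : Fin (n + 1) → Fin k) •
      ((List.ofFn fun b => twoForm d X (adjugate X) (j b) (i b)).prod * d (X q l))

/-- For symmetric `X` with inverse `Y`, the form `∑ (Y_ab Y_ce - Y_ac Y_be) dX_pa dX_bq dX_p'c dX_eq'`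
multiplied by `det X`. -/
def fourForm (d : Derivation ℚ A R) (X : Matrix (Fin k) (Fin k) A) (p q p' q' : Fin k) : R :=
  ∑ a, ∑ b, ∑ c, ∑ e, borderedMinor X ![a, e] ![b, c] •
    (d (X p a) * d (X b q) * (d (X p' c) * d (X e q')))

/-- The form `det(X)^{n+1} β^{4n+1}_X` for symmetric `X`, as a polynomial in the entries of `X` and
`dX`. -/
def symTraceNumerator (d : Derivation ℚ A R) (X : Matrix (Fin k) (Fin k) A) (n : ℕ) : R :=
  (totalCrossWeight n * (n * 2).factorial : ℚ)⁻¹ • ∑ f : PairedSlots n ⊕ PairedSlots n → Fin k,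
    borderedMinor X (f ∘ Sum.inl) (f ∘ Sum.inr) •
      ((List.ofFn fun s : Fin n => fourForm d X
        (f (.inr (some (s, false)))) (f (.inl (some (s, false))))
        (f (.inr (some (s, true)))) (f (.inl (some (s, true))))).prod *
          d (X (f (.inr none)) (f (.inl none))))

section Map

variable {A' : Type*} [CommRing A'] [Algebra ℚ A'] {R' : Type*} [Ring R'] [Algebra ℚ R']
  [Algebra A' R'] {d : Derivation ℚ A R} {d' : Derivation ℚ A' R'} {φ : R →+* R'} {f : A →+* A'}

theorem map_twoForm (hφ : ∀ a, φ (algebraMap A R a) = algebraMap A' R' (f a))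
    (hd : ∀ a, φ (d a) = d' (f a)) (X Z : Matrix (Fin k) (Fin k) A) (i j : Fin k) :
    φ (twoForm d X Z i j) = twoForm d' (X.map f) (Z.map f) i j := by
  simp [twoForm, Algebra.smul_def, hφ, hd]

theorem map_fourForm (hφ : ∀ a, φ (algebraMap A R a) = algebraMap A' R' (f a))
    (hd : ∀ a, φ (d a) = d' (f a)) (X : Matrix (Fin k) (Fin k) A) (p q p' q' : Fin k) :
    φ (fourForm d X p q p' q') = fourForm d' (X.map f) p q p' q' := by
  simp [fourForm, Algebra.smul_def, hφ, hd, map_borderedMinor]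

theorem map_traceNumerator (hφ : ∀ a, φ (algebraMap A R a) = algebraMap A' R' (f a))
    (hd : ∀ a, φ (d a) = d' (f a)) (X : Matrix (Fin k) (Fin k) A) (n : ℕ) :
    φ (traceNumerator d X n) = traceNumerator d' (X.map f) n := by
  have hadj : (adjugate X).map f = adjugate (X.map f) := f.map_adjugate X
  simp only [traceNumerator, map_rat_smul, map_sum, Algebra.smul_def (R := A),
    Algebra.smul_def (R := A'), map_mul, hφ, hd, map_borderedMinor, map_list_prod, List.map_ofFn,
    Function.comp_def, map_twoForm hφ hd, hadj, map_apply]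

theorem map_symTraceNumerator (hφ : ∀ a, φ (algebraMap A R a) = algebraMap A' R' (f a))
    (hd : ∀ a, φ (d a) = d' (f a)) (X : Matrix (Fin k) (Fin k) A) (n : ℕ) :
    φ (symTraceNumerator d X n) = symTraceNumerator d' (X.map f) n := by
  simp only [symTraceNumerator, map_rat_smul, map_sum, Algebra.smul_def (R := A),
    Algebra.smul_def (R := A'), map_mul, hφ, hd, map_borderedMinor, map_list_prod, List.map_ofFn,
    Function.comp_def, map_fourForm hφ hd, map_apply]

end Map

section Degree

variable {d : Derivation ℚ A R} {𝒢 : ℕ → Submodule A R} [SetLike.GradedMonoid 𝒢]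

theorem traceNumerator_mem (hd : ∀ a, d a ∈ 𝒢 1) (X : Matrix (Fin k) (Fin k) A) (n : ℕ) :
    traceNumerator d X n ∈ 𝒢 (2 * n + 1) := by
  refine Submodule.smul_of_tower_mem _ _ (Submodule.sum_mem _ fun l _ => Submodule.sum_mem _
    fun q _ => Submodule.sum_mem _ fun i _ => Submodule.sum_mem _ fun j _ =>
    Submodule.smul_mem _ _ (SetLike.GradedMul.mul_mem ?_ (hd _)))
  have h := SetLike.list_prod_ofFn_mem_graded (A := 𝒢) (fun _ : Fin n => 2)
    (fun b => twoForm d X (adjugate X) (j b) (i b)) fun b =>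
    Submodule.sum_mem _ fun a _ => Submodule.sum_mem _ fun b _ =>
    Submodule.smul_mem _ _ (SetLike.GradedMul.mul_mem (hd _) (hd _))
  simpa [mul_comm] using h

theorem symTraceNumerator_mem (hd : ∀ a, d a ∈ 𝒢 1) (X : Matrix (Fin k) (Fin k) A) (n : ℕ) :
    symTraceNumerator d X n ∈ 𝒢 (4 * n + 1) := by
  refine Submodule.smul_of_tower_mem _ _ (Submodule.sum_mem _ fun f _ =>
    Submodule.smul_mem _ _ (SetLike.GradedMul.mul_mem ?_ (hd _)))
  have h := SetLike.list_prod_ofFn_mem_graded (A := 𝒢) (fun _ : Fin n => 4)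
    (fun s => fourForm d X
        (f (.inr (some (s, false)))) (f (.inl (some (s, false))))
        (f (.inr (some (s, true)))) (f (.inl (some (s, true))))) fun s =>
    Submodule.sum_mem _ fun a _ => Submodule.sum_mem _ fun b _ => Submodule.sum_mem _ fun c _ =>
    Submodule.sum_mem _ fun e _ => Submodule.smul_mem _ _
      (SetLike.GradedMul.mul_mem (i := 2) (j := 2) (SetLike.GradedMul.mul_mem (hd _) (hd _))
        (SetLike.GradedMul.mul_mem (hd _) (hd _)))
  simpa [mul_comm] using h

end Degree

/-- The minors of `X⁻¹` of size `n + 1` have a simple pole along `det X`, and so has each of the `n`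
factors `dX X⁻¹ dX`. -/
theorem invariantTrace_eq_smul_traceNumerator (d : Derivation ℚ A R)
    (hd : ∀ a b, d a * d b = -(d b * d a)) (X : GL (Fin k) A) (n : ℕ) :
    invariantTrace d X (2 * n + 1) =
      ((GeneralLinearGroup.det X)⁻¹ ^ (n + 1)).val • traceNumerator d X.val n := by
  obtain ⟨C, _, _, ψ, E, hψ, hc, hE⟩ := exists_evenForms d hd
  set u := (GeneralLinearGroup.det X)⁻¹ with hu
  have hS := trace_pow_evenMatrix hd hψ hc hE X.val (X⁻¹).val
  have hE2 : ∀ i j, ψ (evenMatrix E X.val (X⁻¹).val i j) =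
      u.val • twoForm d X.val (adjugate X.val) i j := by
    intro i j
    simp only [evenMatrix, of_apply, map_sum, map_smul, hE, twoForm, Finset.smul_sum,
      val_inv_eq_smul_adjugate, Matrix.smul_apply, smul_assoc, hu]
  have hterm : ∀ l q, ψ (((((X⁻¹).val.map (algebraMap A C) * evenMatrix E X.val (X⁻¹).val) ^ n) *
        (X⁻¹).val.map (algebraMap A C)) l q) =
      ((-1) ^ n * n.factorial : ℚ)⁻¹ • (u ^ (n + 1)).val •
        ∑ i : Fin n → Fin k, ∑ j : Fin n → Fin k,
        borderedMinor X.val (Fin.cons l i : Fin (n + 1) → Fin k)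
          (Fin.cons q j : Fin (n + 1) → Fin k) •
        (List.ofFn fun b => twoForm d X.val (adjugate X.val) (j b) (i b)).prod := by
    intro l q
    have h := congrArg ψ (sum_minor_mul_prod _ _ hS n l q)
    have hne : ((-1) ^ n * n.factorial : ℚ) ≠ 0 :=
      mul_ne_zero (pow_ne_zero _ (by norm_num)) (by exact_mod_cast n.factorial_ne_zero)
    rw [eq_inv_smul_iff₀ hne, Algebra.smul_def]
    simp only [map_mul, map_pow, map_neg, map_one, map_natCast] at h ⊢
    rw [← h, map_sum, Finset.smul_sum]
    refine Finset.sum_congr rfl fun i _ => ?_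
    rw [map_sum, Finset.smul_sum]
    refine Finset.sum_congr rfl fun j _ => ?_
    rw [map_mul, det_map_inv_submatrix, AlgHom.commutes, ← List.prod_ofFn, map_list_prod,
      List.map_ofFn, Function.comp_def]
    simp only [hE2]
    rw [List.prod_ofFn_smul, ← Algebra.smul_def, smul_smul, smul_smul]
    congr 1
    rw [Units.val_pow_eq_pow_val]
    ring
  rw [invariantTrace_odd hE, traceNumerator, smul_comm (u ^ (n + 1)).val, Finset.smul_sum,
    Finset.smul_sum]
  refine Finset.sum_congr rfl fun l _ => ?_
  rw [Finset.smul_sum, Finset.smul_sum]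
  refine Finset.sum_congr rfl fun q _ => ?_
  rw [hterm]
  simp only [smul_mul_assoc, Finset.sum_mul]

/-- Contracting the minors of `X⁻¹` of size `2n + 1` with `n` factors that are linear in its minors of
size two gives the pole order `n + 1`. -/
theorem invariantTrace_eq_smul_symTraceNumerator (d : Derivation ℚ A R)
    (hd : ∀ a b, d a * d b = -(d b * d a)) (X : GL (Fin k) A) (hX : X.val.IsSymm) (n : ℕ) :
    invariantTrace d X (4 * n + 1) =
      ((GeneralLinearGroup.det X)⁻¹ ^ (n + 1)).val • symTraceNumerator d X.val n := by
  obtain ⟨C, _, _, ψ, E, hψ, hc, hE⟩ := exists_evenForms d hd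
  set u := (GeneralLinearGroup.det X)⁻¹ with hu
  have hS := trace_pow_evenMatrix hd hψ hc hE X.val (X⁻¹).val
  have hEanti : ∀ a b, E a b = -E b a := fun a b => hψ (by rw [map_neg, hE, hE, hd])
  have hYs : (X⁻¹).val.IsSymm := by
    rw [Matrix.coe_units_inv]; exact hX.inv
  set Y := (X⁻¹).val.map (algebraMap A C) with hY
  set B := evenMatrix E X.val (X⁻¹).val with hB
  have hYsymm : Y.IsSymm := hYs.map _
  have hBanti : Bᵀ = -B := by
    ext i j
    simp only [hB, evenMatrix, transpose_apply, Matrix.neg_apply, of_apply,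
      ← Finset.sum_neg_distrib]
    rw [Finset.sum_comm]
    refine Finset.sum_congr rfl fun a _ => Finset.sum_congr rfl fun b _ => ?_
    rw [hEanti, hX.apply a i, hX.apply j b, hYs.apply, smul_neg]
  have hg : (X.val.map d).IsSymm := hX.map _
  let _ : Module C R := Module.compHom R (ψ : C →+* R)
  have hsmul : ∀ (c : C) (r : R), c • r = ψ c * r := fun _ _ => rfl
  have hfour : ∀ (f : PairedSlots n ⊕ PairedSlots n → Fin k) (s : Fin n),
      ψ (straightTerm B f s + crossTerm B f s) = u.val • fourForm d X.val
        (f (.inr (some (s, false)))) (f (.inl (some (s, false))))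
        (f (.inr (some (s, true)))) (f (.inl (some (s, true)))) := by
    intro f s
    simp only [straightTerm, crossTerm]
    generalize f (.inr (some (s, false))) = p
    generalize f (.inl (some (s, false))) = q
    generalize f (.inr (some (s, true))) = p'
    generalize f (.inl (some (s, true))) = q'
    have hprod : ∀ p q p' q', ψ (B p q * B p' q') = ∑ a, ∑ b, ∑ c, ∑ e,
        ((X⁻¹).val a b * (X⁻¹).val c e) •
          (d (X.val p a) * d (X.val b q) * (d (X.val p' c) * d (X.val e q'))) := by
      intro p q p' q'
      simp only [hB, evenMatrix, of_apply, map_mul, map_sum, map_smul, hE]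
      rw [Finset.sum_mul]
      refine Finset.sum_congr rfl fun a _ => ?_
      rw [Finset.sum_mul]
      refine Finset.sum_congr rfl fun b _ => ?_
      rw [Finset.mul_sum]
      refine Finset.sum_congr rfl fun c _ => ?_
      rw [Finset.mul_sum]
      refine Finset.sum_congr rfl fun e _ => ?_
      rw [smul_mul_smul_comm]
    -- exchanging the two inner one-forms of the crossed product costs a sign
    have hcross : ψ (B p p' * B q q') = ∑ a, ∑ b, ∑ c, ∑ e,
        (-((X⁻¹).val a c * (X⁻¹).val b e)) •
          (d (X.val p a) * d (X.val b q) * (d (X.val p' c) * d (X.val e q'))) := by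
      rw [hprod]
      refine Finset.sum_congr rfl fun a _ => ?_
      rw [Finset.sum_comm]
      refine Finset.sum_congr rfl fun b _ => Finset.sum_congr rfl fun c _ =>
        Finset.sum_congr rfl fun e _ => ?_
      rw [neg_smul, ← smul_neg]
      congr 1
      rw [hX.apply b q, hX.apply p' c, mul_assoc, mul_assoc, ← mul_assoc (d (X.val p' c)), hd,
        neg_mul, mul_neg, mul_assoc]
    rw [map_add, hprod, hcross, fourForm]
    simp only [Finset.smul_sum, ← Finset.sum_add_distrib, smul_smul, ← add_smul]
    refine Finset.sum_congr rfl fun a _ => Finset.sum_congr rfl fun b _ =>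
      Finset.sum_congr rfl fun c _ => Finset.sum_congr rfl fun e _ => ?_
    congr 1
    rw [← det_inv_submatrix, det_fin_two]
    simp only [submatrix_apply, cons_val_zero, cons_val_one]
    rw [hYs.apply c e, hYs.apply e b]
    ring
  have h1 : totalCrossWeight n • ((n * 2).factorial : ℚ) • invariantTrace d X (4 * n + 1) =
      minorPairing Y fun f : PairedSlots n ⊕ PairedSlots n → Fin k =>
        (∏ s, (straightTerm B f s + crossTerm B f s)) •
          (X.val.map d) (f (.inr none)) (f (.inl none)) := by
    rw [minorPairing_prod_add hYsymm hBanti hg, minorPairing_mixedTensor_empty hS,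
      show 4 * n + 1 = 2 * (n * 2) + 1 by ring, invariantTrace_odd hE]
    rfl
  have hne : (totalCrossWeight n * (n * 2).factorial : ℚ) ≠ 0 :=
    mul_ne_zero (totalCrossWeight_pos n).ne' (by exact_mod_cast (n * 2).factorial_ne_zero)
  rw [symTraceNumerator, smul_comm, eq_inv_smul_iff₀ hne, mul_smul, h1, minorPairing,
    Finset.smul_sum]
  refine Finset.sum_congr rfl fun f _ => ?_
  rw [hsmul, hsmul, minorAt, hY, det_map_inv_submatrix, AlgHom.commutes, ← Algebra.smul_def,
    ← List.prod_ofFn, map_list_prod, List.map_ofFn, show ψ ∘ _ = _ from funext (hfour f),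
    List.prod_ofFn_smul, smul_mul_assoc, smul_smul, smul_smul, map_apply]
  congr 1
  rw [Units.val_pow_eq_pow_val]
  ring

end Numerators

/-! ### Generic matrices and specialization -/

section Specialization

variable {k : ℕ}

theorem kahlerD_mem (B : Type*) [CommRing B] [Algebra ℚ B] (b : B) :
    kahlerD B b ∈ ⋀[B]^1 Ω[B⁄ℚ] := by
  change _ ∈ LinearMap.range (ExteriorAlgebra.ι B) ^ 1
  rw [pow_one]
  exact LinearMap.mem_range_self _ _

variable {A : Type*} [CommRing A] [Algebra ℚ A] {R : Type*} [Ring R] [Algebra ℚ R] [Algebra A R]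
  (d : Derivation ℚ A R) (hd : ∀ a b, d a * d b = -(d b * d a))
  {B : Type*} [CommRing B] [Algebra ℚ B] (f : B →ₐ[ℚ] A)

theorem specialize_traceNumerator (X : Matrix (Fin k) (Fin k) B) (n : ℕ) :
    specialize d hd f (traceNumerator (kahlerD B) X n) = traceNumerator d (X.map f) n :=
  map_traceNumerator (f := (f : B →+* A)) (specialize_algebraMap d hd f)
    (specialize_kahlerD d hd f) X n

theorem specialize_symTraceNumerator (X : Matrix (Fin k) (Fin k) B) (n : ℕ) :
    specialize d hd f (symTraceNumerator (kahlerD B) X n) = symTraceNumerator d (X.map f) n :=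
  map_symTraceNumerator (f := (f : B →+* A)) (specialize_algebraMap d hd f)
    (specialize_kahlerD d hd f) X n

end Specialization

theorem symMatrix_isSymm (k : ℕ) : (symMatrix k).IsSymm := by
  ext i j
  simp [symMatrix, Sym2.eq_swap]

theorem mainTheorem6 (k : ℕ) :
    -- `β¹_X = d log det X` for every invertible matrix over the degree zero part of a
    -- graded-commutative dg algebra, and for the two generic matrices
    (∀ (R : Type u) [Ring R] [Algebra ℚ R] (𝒜 : ℕ → Submodule ℚ R) [GradedAlgebra 𝒜]
        [CommDGAlgebra 𝒜] (X : GL (Fin k) (𝒜 0)),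
      invariantTrace (CommDGAlgebra.dZero 𝒜) X 1 =
        dlog (CommDGAlgebra.dZero 𝒜) (Matrix.GeneralLinearGroup.det X)) ∧
    invariantTrace (kahlerD (FractionRing (GenRing k))) (genGL k) 1 =
      dlog (kahlerD (FractionRing (GenRing k))) (Matrix.GeneralLinearGroup.det (genGL k)) ∧
    invariantTrace (kahlerD (FractionRing (SymRing k))) (symGL k) 1 =
      dlog (kahlerD (FractionRing (SymRing k))) (Matrix.GeneralLinearGroup.det (symGL k)) ∧
    -- `β^{2n+1}_X` is a polynomial form divided by `det(X)^{n+1}`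
    (∀ n : ℕ, ∃ η ∈ ⋀[GenRing k]^(2 * n + 1) Ω[GenRing k⁄ℚ],
      invariantTrace (kahlerD (FractionRing (GenRing k))) (genGL k) (2 * n + 1) =
        ((Matrix.GeneralLinearGroup.det (genGL k))⁻¹ ^ (n + 1)).val •
          toFractionForms (Fin k × Fin k) η ∧
      ∀ (R : Type u) [Ring R] [Algebra ℚ R] (𝒜 : ℕ → Submodule ℚ R) [GradedAlgebra 𝒜]
        [CommDGAlgebra 𝒜] (X : GL (Fin k) (𝒜 0)),
        invariantTrace (CommDGAlgebra.dZero 𝒜) X (2 * n + 1) =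
          ((Matrix.GeneralLinearGroup.det X)⁻¹ ^ (n + 1)).val •
            specialize (CommDGAlgebra.dZero 𝒜) (CommDGAlgebra.dZero_anticomm 𝒜)
              (MvPolynomial.aeval fun p : Fin k × Fin k => X.val p.1 p.2) η) ∧
    -- for symmetric `X`, `β^{4n+1}_X` is a polynomial form divided by `det(X)^{n+1}`
    (∀ n : ℕ, ∃ η ∈ ⋀[SymRing k]^(4 * n + 1) Ω[SymRing k⁄ℚ],
      invariantTrace (kahlerD (FractionRing (SymRing k))) (symGL k) (4 * n + 1) =
        ((Matrix.GeneralLinearGroup.det (symGL k))⁻¹ ^ (n + 1)).val •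
          toFractionForms (Sym2 (Fin k)) η ∧
      ∀ (R : Type u) [Ring R] [Algebra ℚ R] (𝒜 : ℕ → Submodule ℚ R) [GradedAlgebra 𝒜]
        [CommDGAlgebra 𝒜] (X : GL (Fin k) (𝒜 0)) (hX : X.val.IsSymm),
        invariantTrace (CommDGAlgebra.dZero 𝒜) X (4 * n + 1) =
          ((Matrix.GeneralLinearGroup.det X)⁻¹ ^ (n + 1)).val •
            specialize (CommDGAlgebra.dZero 𝒜) (CommDGAlgebra.dZero_anticomm 𝒜)
              (MvPolynomial.aeval (symEntries X.val hX)) η) := by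
  refine ⟨fun R _ _ 𝒜 _ _ X => invariantTrace_one _ X, invariantTrace_one _ _,
    invariantTrace_one _ _, fun n => ⟨traceNumerator (kahlerD _) (genMatrix k) n,
      traceNumerator_mem (𝒢 := fun m => ⋀[GenRing k]^m Ω[GenRing k⁄ℚ]) (kahlerD_mem _) _ n, ?_,
      fun R _ _ 𝒜 _ _ X => ?_⟩,
    fun n => ⟨symTraceNumerator (kahlerD _) (symMatrix k) n,
      symTraceNumerator_mem (𝒢 := fun m => ⋀[SymRing k]^m Ω[SymRing k⁄ℚ]) (kahlerD_mem _) _ n, ?_,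
      fun R _ _ 𝒜 _ _ X hX => ?_⟩⟩
  · rw [invariantTrace_eq_smul_traceNumerator _ (kahlerD_anticomm _), toFractionForms,
      specialize_traceNumerator]
    rfl
  · rw [invariantTrace_eq_smul_traceNumerator _ (CommDGAlgebra.dZero_anticomm 𝒜),
      specialize_traceNumerator]
    congr 2
    ext i j
    simp [genMatrix]
  · rw [invariantTrace_eq_smul_symTraceNumerator _ (kahlerD_anticomm _) _
      ((symMatrix_isSymm k).map _), toFractionForms, specialize_symTraceNumerator]
    rfl
  · rw [invariantTrace_eq_smul_symTraceNumerator _ (CommDGAlgebra.dZero_anticomm 𝒜) _ hX,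
      specialize_symTraceNumerator]
    congr 2
    ext i j
    simp [symMatrix, symEntries]
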